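/- Let $\mathbb F$ be $\mathbb R$ or $\mathbb C$, let $d\ge 0$, and for $k=1,\dots,d$ let $m_k, n_k, n_{Kk}\ge 0$ be integers. Set $\mathcal X=\bigoplus_{k=1}^d\mathbb F^{n_km_k}$ and $\mathcal X_K=\bigoplus_{k=1}^d\mathbb F^{n_{Kk}m_k}$. Define $$\boldsymbol\Delta=\{\operatorname{diag}(\Delta^0_1\otimes I_{n_1},\dots,\Delta^0_d\otimes I_{n_d}) : \Delta^0_k\in\mathbb F^{m_k\times m_k}\},$$ and, with the same $\Delta^0_k$ in both groups of blocks, $$\boldsymbol\Delta_{cl}=\{\operatorname{diag}(\Delta^0_1\otimes I_{n_1},\dots,\Delta^0_d\otimes I_{n_d},\ \Delta^0_1\otimes I_{n_{K1}},\dots,\Delta^0_d\otimes I_{n_{Kd}}) : \Delta^0_k\in\mathbb F^{m_k\times m_k}\},$$ where $\Delta^0\otimes I_n$ is the block matrix with blocks $\delta_{ij}I_n$. Let $\mathcal D_{\boldsymbol\Delta}$, $\mathcal D_{\boldsymbol\Delta_{cl}}$ be their commutants in $\mathcal L(\mathcal X)$ and $\mathcal L(\mathcal X\oplus\mathcal X_K)$.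 Let a plant be given by matrices $$\begin{bmatrix} A & B_1 & B_2\\ C_1& D_{11}& D_{12}\\ C_2& D_{21}& D_{22}\end{bmatrix}:\mathcal X\oplus\mathcal U_1\oplus\mathcal U_2\to\mathcal X\oplus\mathcal Y_1\oplus\mathcal Y_2,$$ with finite-dimensional $\mathcal U_i=\mathbb F^{r_i}$ and $\mathcal Y_i=\mathbb F^{s_i}$. A controller with dimension indices $n_{K1},\dots,n_{Kd}$ is a matrix $\begin{bmatrix}A_K&B_K\\C_K&D_K\end{bmatrix}:\mathcal X_K\oplus\mathcal Y_2\to\mathcal X_K\oplus\mathcal U_2$. The loop is well-posed if $I-D_{22}D_K$ is invertible (automatic if $D_{22}=0$). In that case the closed-loop state matrix on $\mathcal X\oplus\mathcal X_K$ is $$A_{cl}=\begin{bmatrix}A&0\\0&0\end{bmatrix}+\begin{bmatrix}0&B_2\\I&0\end{bmatrix}\left(I-\begin{bmatrix}A_K&B_K\\C_K&D_K\end{bmatrix}\begin{bmatrix}0&0\\0&D_{22}\end{bmatrix}\right)^{-1}\begin{bmatrix}A_K&B_K\\C_K&D_K\end{bmatrix}\begin{bmatrix}0&I\\C_2&0\end{bmatrix},$$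 which for $D_{22}=0$ is $\begin{bmatrix}A+B_2D_KC_2&B_2C_K\\B_KC_2&A_K\end{bmatrix}$. The closed-loop system is $\mathcal Q$-stable if there is an invertible $Q\in\mathcal D_{\boldsymbol\Delta_{cl}}$ with $\|Q^{-1}A_{cl}Q\|<1$ (operator norm induced by the Euclidean norm). Let $B_\perp$ and $C_\perp$ be matrices such that $B_\perp$ is injective with $\operatorname{Im}B_\perp=\operatorname{Ker}B_2^*$, and $C_\perp^*$ is injective with $\operatorname{Im}C_\perp^*=\operatorname{Ker}C_2$. **Theorem.** There exists a controller with the prescribed dimension indices $n_{K1},\dots,n_{Kd}$ for which the loop is well-posed and the closed-loop system is $\mathcal Q$-stable if and only if there exist positive-definite $X,Y\in\mathcal D_{\boldsymbol\Delta}$ such that $$B_\perp^*AYA^*B_\perp-B_\perp^*YB_\perp<0,\qquad C_\perp A^*XAC_\perp^*-C_\perp XC_\perp^*<0,$$ and such that $X=\operatorname{diag}(X_1,\dots,X_d)$, $Y=\operatorname{diag}(Y_1,\dots,Y_d)$ with $X_k=\operatorname{diag}(X_{k,0},\dots,X_{k,0})$, $Y_k=\operatorname{diag}(Y_{k,0},\dots,Y_{k,0})$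 ($m_k$ repeated blocks of size $n_k\times n_k$), where for every $k=1,\dots,d$ $$\begin{bmatrix}X_{k,0}&I\\I&Y_{k,0}\end{bmatrix}\ge0\quad\text{and}\quad\operatorname{rank}\begin{bmatrix}X_{k,0}&I\\I&Y_{k,0}\end{bmatrix}\le n_k+n_{Kk}.$$ -/

import Mathlib

namespace LFT

open scoped Kronecker

/-- Coordinates of the state space `⊕ₖ 𝔽^(nₖ·mₖ)`: the coordinate `⟨k, (i, a)⟩` is the `a`-th
entry of the `i`-th of the `mₖ` consecutive subblocks (each of size `nₖ`) of the `k`-th summand. -/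
abbrev StateIdx {d : ℕ} (m n : Fin d → ℕ) : Type :=
  Σ k : Fin d, Fin (m k) × Fin (n k)

/-- `diag(Δ⁰₁ ⊗ I_{n₁}, …, Δ⁰_d ⊗ I_{n_d})`. -/
def uncertainty {𝕜 : Type*} [RCLike 𝕜] {d : ℕ} {m : Fin d → ℕ} (n : Fin d → ℕ)
    (δ : ∀ k : Fin d, Matrix (Fin (m k)) (Fin (m k)) 𝕜) :
    Matrix (StateIdx m n) (StateIdx m n) 𝕜 :=
  Matrix.blockDiagonal' fun k => δ k ⊗ₖ (1 : Matrix (Fin (n k)) (Fin (n k)) 𝕜)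

/-- The uncertainty structure `𝚫`: all `diag(Δ⁰ₖ ⊗ I_{nₖ})`, the `Δ⁰ₖ` being arbitrary
`mₖ × mₖ` matrices. -/
def openStructure (𝕜 : Type*) [RCLike 𝕜] {d : ℕ} (m n : Fin d → ℕ) :
    Set (Matrix (StateIdx m n) (StateIdx m n) 𝕜) :=
  Set.range fun δ : (∀ k : Fin d, Matrix (Fin (m k)) (Fin (m k)) 𝕜) => uncertainty n δ

/-- The coupled closed-loop structure: the same `Δ⁰ₖ` act on the plant state with multiplicity
`nₖ` and on the controller state with multiplicity `n_{Kk}`. -/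
def closedLoopStructure (𝕜 : Type*) [RCLike 𝕜] {d : ℕ} (m n nK : Fin d → ℕ) :
    Set (Matrix (StateIdx m n ⊕ StateIdx m nK) (StateIdx m n ⊕ StateIdx m nK) 𝕜) :=
  Set.range fun δ : (∀ k : Fin d, Matrix (Fin (m k)) (Fin (m k)) 𝕜) =>
    Matrix.fromBlocks (uncertainty n δ) 0 0 (uncertainty nK δ)

/-- The commutant `𝒟_𝚫` of a set of matrices. -/
def commutant {𝕜 ι : Type*} [RCLike 𝕜] [Fintype ι] (S : Set (Matrix ι ι 𝕜)) :
    Set (Matrix ι ι 𝕜) :=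
  {X | ∀ D ∈ S, X * D = D * X}

/-- `𝒬`-stability of a state matrix `A` with respect to the structure `S`:
`‖Q⁻¹ A Q‖ < 1` for some invertible `Q` in the commutant of `S`, in the operator norm
induced by the Euclidean norm. -/
def IsQStable {𝕜 ι : Type*} [RCLike 𝕜] [Fintype ι] [DecidableEq ι] (S : Set (Matrix ι ι 𝕜))
    (A : Matrix ι ι 𝕜) : Prop :=
  ∃ Q ∈ commutant S, IsUnit Q ∧ ‖Matrix.toEuclideanCLM (n := ι) (𝕜 := 𝕜) (Q⁻¹ * A * Q)‖ < 1

/-- The system matrix of the plant: state space `⊕ₖ 𝔽^(nₖ·mₖ)`, disturbance and control inputs of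
dimensions `r₁`, `r₂`, error and measurement outputs of dimensions `s₁`, `s₂`. -/
structure Plant (𝕜 : Type*) {d : ℕ} (m n : Fin d → ℕ) (r₁ r₂ s₁ s₂ : ℕ) where
  A : Matrix (StateIdx m n) (StateIdx m n) 𝕜
  B₁ : Matrix (StateIdx m n) (Fin r₁) 𝕜
  B₂ : Matrix (StateIdx m n) (Fin r₂) 𝕜
  C₁ : Matrix (Fin s₁) (StateIdx m n) 𝕜
  C₂ : Matrix (Fin s₂) (StateIdx m n) 𝕜
  D₁₁ : Matrix (Fin s₁) (Fin r₁) 𝕜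
  D₁₂ : Matrix (Fin s₁) (Fin r₂) 𝕜
  D₂₁ : Matrix (Fin s₂) (Fin r₁) 𝕜
  D₂₂ : Matrix (Fin s₂) (Fin r₂) 𝕜

/-- The system matrix of a controller with state space `⊕ₖ 𝔽^(n_{Kk}·mₖ)`, from the measurements
(dimension `s₂`) to the controls (dimension `r₂`). -/
structure Controller (𝕜 : Type*) {d : ℕ} (m nK : Fin d → ℕ) (r₂ s₂ : ℕ) where
  A : Matrix (StateIdx m nK) (StateIdx m nK) 𝕜
  B : Matrix (StateIdx m nK) (Fin s₂) 𝕜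
  C : Matrix (Fin r₂) (StateIdx m nK) 𝕜
  D : Matrix (Fin r₂) (Fin s₂) 𝕜

/-- The lower linear fractional transformation `A + B (I - K D)⁻¹ K C`. -/
noncomputable def lowerLFT {𝕜 α ι γ κ : Type*} [RCLike 𝕜] [Fintype γ] [DecidableEq γ] [Fintype κ]
    (A : Matrix α ι 𝕜) (B : Matrix α γ 𝕜) (C : Matrix κ ι 𝕜) (D : Matrix κ γ 𝕜)
    (K : Matrix γ κ 𝕜) : Matrix α ι 𝕜 :=
  A + B * (1 - K * D)⁻¹ * K * C

section

variable {𝕜 : Type*} [RCLike 𝕜] {d : ℕ} {m n nK : Fin d → ℕ} {r₁ r₂ s₁ s₂ : ℕ}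

/-- The feedback loop is well-posed when `I - D₂₂ D_K` is invertible. -/
def WellPosed (P : Plant 𝕜 m n r₁ r₂ s₁ s₂) (K : Controller 𝕜 m nK r₂ s₂) : Prop :=
  IsUnit (1 - P.D₂₂ * K.D)

/-- The closed-loop system matrix
`[A_cl, B_cl; C_cl, D_cl]`, acting from `(x, x_K), u₁` to `(x, x_K), y₁`. -/
noncomputable def closedLoop (P : Plant 𝕜 m n r₁ r₂ s₁ s₂) (K : Controller 𝕜 m nK r₂ s₂) :
    Matrix ((StateIdx m n ⊕ StateIdx m nK) ⊕ Fin s₁)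
      ((StateIdx m n ⊕ StateIdx m nK) ⊕ Fin r₁) 𝕜 :=
  lowerLFT
    (Matrix.fromBlocks (Matrix.fromBlocks P.A 0 0 0) (Matrix.fromRows P.B₁ 0)
      (Matrix.fromCols P.C₁ 0) P.D₁₁)
    (Matrix.fromRows (Matrix.fromBlocks 0 P.B₂ 1 0) (Matrix.fromCols 0 P.D₁₂))
    (Matrix.fromCols (Matrix.fromBlocks 0 1 P.C₂ 0) (Matrix.fromRows 0 P.D₂₁))
    (Matrix.fromBlocks (0 : Matrix (StateIdx m nK) (StateIdx m nK) 𝕜) 0 0 P.D₂₂)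
    (Matrix.fromBlocks K.A K.B K.C K.D)

/-- The closed-loop state matrix `A_cl`. -/
noncomputable def closedLoopA (P : Plant 𝕜 m n r₁ r₂ s₁ s₂) (K : Controller 𝕜 m nK r₂ s₂) :
    Matrix (StateIdx m n ⊕ StateIdx m nK) (StateIdx m n ⊕ StateIdx m nK) 𝕜 :=
  (closedLoop P K).toBlocks₁₁

/-- The closed-loop system (with the coupled closed-loop structure) is `𝒬`-stable. -/
def ClosedLoopQStable (P : Plant 𝕜 m n r₁ r₂ s₁ s₂) (K : Controller 𝕜 m nK r₂ s₂) : Prop :=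
  IsQStable (closedLoopStructure 𝕜 m n nK) (closedLoopA P K)

/-- `diag(X₁, …, X_d)` where `Xₖ = diag(X_{k,0}, …, X_{k,0})` with `mₖ` repeated blocks. -/
def repeatedBlocks (m : Fin d → ℕ) (X₀ : ∀ k : Fin d, Matrix (Fin (n k)) (Fin (n k)) 𝕜) :
    Matrix (StateIdx m n) (StateIdx m n) 𝕜 :=
  Matrix.blockDiagonal' fun k => (1 : Matrix (Fin (m k)) (Fin (m k)) 𝕜) ⊗ₖ X₀ k

end

end LFT

open scoped ComplexOrder

/-!
For a fixed scaling `Q`, the inequality `‖Q⁻¹ A_cl Q‖ < 1` asks for a strict contraction of the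
form `M + U K V` with a free gain `K`. By Parrott's theorem such a `K` exists iff `M` is a strict
contraction on `ker V` and `M*` is one on `ker U*`. Because the controller state enters `U` and `V`
through identity blocks, these two conditions only involve the corners `Y` of `Q Q*` and `X` of
`(Q Q*)⁻¹`, and they become the two projected inequalities. Well-posedness is a generic condition
on the gain, so a small perturbation achieves it without losing the strict norm bound.

An invertible `Q` in the commutant amounts to a family of invertible matrices of sizes
`n_k + n_{Kk}`. A pair `X₀`, `Y₀` is the pair of corners coming from such a matrix iff
`[X₀, I; I, Y₀]` is a Gram matrix of vectors in dimension `n_k + n_{Kk}`; this is the coupling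
condition, the missing rows and columns being supplied by completing a biorthogonal system.
-/

namespace LFT

section Factorization

variable {K E F G H : Type*} [Field K] [AddCommGroup E] [Module K E] [AddCommGroup F] [Module K F]
  [AddCommGroup G] [Module K G] [AddCommGroup H] [Module K H]

theorem exists_comp_comp_self_eq (f : E →ₗ[K] F) : ∃ g : F →ₗ[K] E, f ∘ₗ g ∘ₗ f = f := by
  obtain ⟨s, hs⟩ := f.rangeRestrict.exists_rightInverse_of_surjective f.range_rangeRestrict
  obtain ⟨g, hg⟩ := LinearMap.exists_extend s
  refine ⟨g, LinearMap.ext fun x => ?_⟩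
  have hgf : g (f x) = s (f.rangeRestrict x) := LinearMap.congr_fun hg (f.rangeRestrict x)
  rw [LinearMap.comp_apply, LinearMap.comp_apply, hgf]
  exact congrArg Subtype.val (LinearMap.congr_fun hs (f.rangeRestrict x))

theorem exists_comp_comp_eq (D : E →ₗ[K] F) (U : G →ₗ[K] F) (V : E →ₗ[K] H)
    (hU : D.range ≤ U.range) (hV : V.ker ≤ D.ker) : ∃ f : H →ₗ[K] G, U ∘ₗ f ∘ₗ V = D := by
  obtain ⟨U', hU'⟩ := exists_comp_comp_self_eq U
  obtain ⟨V', hV'⟩ := exists_comp_comp_self_eq V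
  refine ⟨U' ∘ₗ D ∘ₗ V', LinearMap.ext fun x => ?_⟩
  have hDV : D (V' (V x)) = D x := by
    rw [← sub_eq_zero, ← map_sub]
    refine hV ?_
    rw [LinearMap.mem_ker, map_sub, sub_eq_zero]
    exact LinearMap.congr_fun hV' x
  obtain ⟨g, hg⟩ := hU (LinearMap.mem_range_self D x)
  simp only [LinearMap.comp_apply, hDV]
  rw [← hg]
  exact LinearMap.congr_fun hU' g

end Factorization

section Parrott

variable {𝕜 E F : Type*} [RCLike 𝕜]
  [NormedAddCommGroup E] [InnerProductSpace 𝕜 E] [NormedAddCommGroup F] [InnerProductSpace 𝕜 F]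

/-- A linear map that strictly decreases the norm of every nonzero vector. On a finite-dimensional
space this amounts to an operator norm less than `1`. -/
def IsStrictContraction (T : E →ₗ[𝕜] F) : Prop :=
  ∀ x, x ≠ 0 → ‖T x‖ < ‖x‖

theorem IsStrictContraction.norm_le {T : E →ₗ[𝕜] F} (hT : IsStrictContraction T) (x : E) :
    ‖T x‖ ≤ ‖x‖ := by
  rcases eq_or_ne x 0 with rfl | hx
  · simp
  · exact (hT x hx).le

variable [FiniteDimensional 𝕜 E]

theorem exists_norm_le_one_norm_apply_eq (T : E →ₗ[𝕜] F) :
    ∃ x, ‖x‖ ≤ 1 ∧ ‖T x‖ = ‖T.toContinuousLinearMap‖ := by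
  have := FiniteDimensional.proper_rclike 𝕜 E
  have himage : IsCompact ((fun x => ‖T.toContinuousLinearMap x‖) '' Metric.closedBall 0 1) :=
    (isCompact_closedBall 0 1).image (by fun_prop)
  obtain ⟨x, hx, hxT⟩ := himage.sSup_mem ((Metric.nonempty_closedBall.mpr zero_le_one).image _)
  rw [ContinuousLinearMap.sSup_unitClosedBall_eq_norm] at hxT
  exact ⟨x, mem_closedBall_zero_iff.mp hx, hxT⟩

theorem norm_toContinuousLinearMap_lt_one_iff {T : E →ₗ[𝕜] F} :
    ‖T.toContinuousLinearMap‖ < 1 ↔ IsStrictContraction T := by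
  constructor
  · intro h x hx
    calc ‖T x‖ ≤ ‖T.toContinuousLinearMap‖ * ‖x‖ := T.toContinuousLinearMap.le_opNorm x
      _ < 1 * ‖x‖ := by gcongr
      _ = ‖x‖ := one_mul _
  · intro h
    obtain ⟨x, hx, hxT⟩ := exists_norm_le_one_norm_apply_eq T
    rw [← hxT]
    rcases eq_or_ne x 0 with rfl | hx0
    · simp
    · exact (h x hx0).trans_le hx

theorem IsStrictContraction.adjoint [FiniteDimensional 𝕜 F] {T : E →ₗ[𝕜] F}
    (hT : IsStrictContraction T) : IsStrictContraction (LinearMap.adjoint T) := by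
  have := FiniteDimensional.complete 𝕜 E
  have := FiniteDimensional.complete 𝕜 F
  rw [← norm_toContinuousLinearMap_lt_one_iff] at hT ⊢
  rwa [LinearMap.adjoint_toContinuousLinearMap, LinearIsometryEquiv.norm_map]

theorem exists_norm_sq_eq_inner {S : E →ₗ[𝕜] E} (hS : S.IsPositive) :
    ∃ (r : ℕ) (D : E →ₗ[𝕜] EuclideanSpace 𝕜 (Fin r)),
      ∀ x, ((‖D x‖ ^ 2 : ℝ) : 𝕜) = inner 𝕜 x (S x) := by
  have := FiniteDimensional.complete 𝕜 E
  obtain ⟨r, u, hu⟩ := ContinuousLinearMap.isPositive_iff_eq_sum_rankOne.mp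
    (S.isPositive_toContinuousLinearMap_iff.mpr hS)
  let u' : Fin r → E →ₗ[𝕜] 𝕜 := fun i => (innerSL 𝕜 (u i)).toLinearMap
  refine ⟨r, (WithLp.linearEquiv 2 𝕜 (Fin r → 𝕜)).symm ∘ₗ LinearMap.pi u', fun x => ?_⟩
  have hSx : S x = ∑ i, inner 𝕜 (u i) x • u i := by
    simpa using congrArg (fun T : E →L[𝕜] E => T x) hu
  rw [hSx, inner_sum, EuclideanSpace.norm_sq_eq]
  push_cast
  refine Finset.sum_congr rfl fun i _ => ?_
  rw [inner_smul_right, ← inner_conj_symm x (u i), RCLike.mul_conj]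
  rfl

theorem IsStrictContraction.exists_defect [FiniteDimensional 𝕜 F] {C : E →ₗ[𝕜] F}
    (hC : IsStrictContraction C) :
    ∃ (r : ℕ) (D : E →ₗ[𝕜] EuclideanSpace 𝕜 (Fin r)),
      Function.Injective D ∧ ∀ x, ‖D x‖ ^ 2 = ‖x‖ ^ 2 - ‖C x‖ ^ 2 := by
  let S : E →ₗ[𝕜] E := LinearMap.id - LinearMap.adjoint C ∘ₗ C
  have hS_inner (x : E) : inner 𝕜 x (S x) = ((‖x‖ ^ 2 - ‖C x‖ ^ 2 : ℝ) : 𝕜) := by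
    simp only [S, LinearMap.sub_apply, LinearMap.id_apply, LinearMap.comp_apply, inner_sub_right,
      LinearMap.adjoint_inner_right, inner_self_eq_norm_sq_to_K]
    push_cast
    rfl
  have hS : S.IsPositive := by
    rw [LinearMap.isPositive_iff]
    refine ⟨LinearMap.IsSymmetric.id.sub (LinearMap.isSymmetric_adjoint_comp_self C),
      fun x => ?_⟩
    rw [← inner_conj_symm, hS_inner, RCLike.conj_ofReal, RCLike.ofReal_nonneg, sub_nonneg]
    exact pow_le_pow_left₀ (norm_nonneg _) (hC.norm_le x) 2
  obtain ⟨r, D, hD_inner⟩ := exists_norm_sq_eq_inner hS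
  have hD (x : E) : ‖D x‖ ^ 2 = ‖x‖ ^ 2 - ‖C x‖ ^ 2 :=
    RCLike.ofReal_injective ((hD_inner x).trans (hS_inner x))
  refine ⟨r, D, (injective_iff_map_eq_zero D).mpr fun x hx => ?_, hD⟩
  by_contra hx0
  have hDx := hD x
  rw [hx, norm_zero] at hDx
  have := pow_lt_pow_left₀ (hC x hx0) (norm_nonneg _) two_ne_zero
  linarith

theorem IsStrictContraction.exists_projection [FiniteDimensional 𝕜 F] {C : E →ₗ[𝕜] F}
    (hC : IsStrictContraction C) (N : Submodule 𝕜 E) :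
    ∃ z : E →ₗ[𝕜] E, (∀ x, z x ∈ N) ∧ (∀ x ∈ N, z x = x) ∧
      ∀ x, ‖z x‖ ^ 2 - ‖C (z x)‖ ^ 2 ≤ ‖x‖ ^ 2 - ‖C x‖ ^ 2 := by
  obtain ⟨r, D, hD_inj, hD⟩ := hC.exists_defect
  let e : N ≃ₗ[𝕜] N.map D := N.equivMapOfInjective D hD_inj
  have he (x : N.map D) : D (e.symm x) = x := congrArg Subtype.val (e.apply_symm_apply x)
  let z : E →ₗ[𝕜] E :=
    N.subtype ∘ₗ e.symm.toLinearMap ∘ₗ (N.map D).orthogonalProjectionOnto.toLinearMap ∘ₗ D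
  have hDz (x : E) : D (z x) = (N.map D).starProjection (D x) := he _
  refine ⟨z, fun x => Subtype.prop _, fun x hx => hD_inj ?_, fun x => ?_⟩
  · rw [hDz, Submodule.starProjection_eq_self_iff]
    exact Submodule.mem_map_of_mem hx
  · rw [← hD, ← hD, hDz]
    exact pow_le_pow_left₀ (norm_nonneg _) ((N.map D).norm_starProjection_apply_le _) 2

theorem exists_isStrictContraction_extension [FiniteDimensional 𝕜 F] {M : E →ₗ[𝕜] F}
    {N : Submodule 𝕜 E} {L : Submodule 𝕜 F} (hN : ∀ x ∈ N, x ≠ 0 → ‖M x‖ < ‖x‖)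
    (hL : ∀ y ∈ L, y ≠ 0 → ‖LinearMap.adjoint M y‖ < ‖y‖) :
    ∃ T : E →ₗ[𝕜] F, IsStrictContraction T ∧ (∀ x ∈ N, T x = M x) ∧ ∀ x, T x - M x ∈ Lᗮ := by
  let r : F →ₗ[𝕜] F := L.starProjection.toLinearMap
  have hr (y : F) : L.orthogonalProjectionOnto (r y) = L.orthogonalProjectionOnto y :=
    L.orthogonalProjectionOnto_mem_subspace_eq_self _
  have hr_orth (y : F) : Lᗮ.orthogonalProjectionOnto (r y) = 0 :=
    Submodule.orthogonalProjectionOnto_orthogonal_apply_eq_zero (L.starProjection_apply_mem y)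
  let C : E →ₗ[𝕜] L := L.orthogonalProjectionOnto.toLinearMap ∘ₗ M
  have hC : IsStrictContraction C := by
    have hML : IsStrictContraction ((LinearMap.adjoint M).domRestrict L) :=
      fun y hy => hL y y.2 (by simpa using hy)
    convert hML.adjoint
    rw [LinearMap.eq_adjoint_iff]
    intro x y
    rw [LinearMap.domRestrict_apply, LinearMap.adjoint_inner_right]
    exact L.inner_orthogonalProjectionOnto_eq_of_mem_right y (M x)
  obtain ⟨z, hz_mem, hz_fix, hz_le⟩ := hC.exists_projection N
  let T : E →ₗ[𝕜] F := M ∘ₗ z + r ∘ₗ M ∘ₗ (LinearMap.id - z)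
  have hT (x : E) : T x = M (z x) + r (M x - M (z x)) := by
    simp [T]
  refine ⟨T, fun x hx => ?_, fun x hx => ?_, fun x => ?_⟩
  · have hT_proj : L.orthogonalProjectionOnto (T x) = C x := by
      simp [hT, hr, C]
    have hT_orth : Lᗮ.orthogonalProjectionOnto (T x) = Lᗮ.orthogonalProjectionOnto (M (z x)) := by
      simp [hT, hr_orth]
    have hTx := Submodule.norm_sq_eq_add_norm_sq_projection (T x) L
    have hMz : ‖M (z x)‖ ^ 2 = ‖C (z x)‖ ^ 2 + ‖Lᗮ.orthogonalProjectionOnto (M (z x))‖ ^ 2 :=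
      Submodule.norm_sq_eq_add_norm_sq_projection (M (z x)) L
    rw [hT_proj, hT_orth] at hTx
    refine lt_of_pow_lt_pow_left₀ 2 (norm_nonneg _) ?_
    rcases eq_or_ne (z x) 0 with hz0 | hz0
    · have := pow_lt_pow_left₀ (hC x hx) (norm_nonneg _) two_ne_zero
      simp only [hz0, map_zero, norm_zero] at hTx
      linarith
    · have hMzx : ‖M (z x)‖ < ‖z x‖ := hN (z x) (hz_mem x) hz0
      have := pow_lt_pow_left₀ hMzx (norm_nonneg _) two_ne_zero
      linarith [hz_le x]
  · rw [hT, hz_fix x hx, sub_self, map_zero, add_zero]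
  · have : T x - M x = -((M x - M (z x)) - r (M x - M (z x))) := by rw [hT]; abel
    rw [this]
    exact Lᗮ.neg_mem (L.sub_starProjection_mem_orthogonal _)

variable {G H : Type*} [NormedAddCommGroup G] [InnerProductSpace 𝕜 G] [FiniteDimensional 𝕜 G]
  [AddCommGroup H] [Module 𝕜 H]

theorem exists_isStrictContraction_add_comp_iff [FiniteDimensional 𝕜 F] (M : E →ₗ[𝕜] F)
    (U : G →ₗ[𝕜] F) (V : E →ₗ[𝕜] H) :
    (∃ K : H →ₗ[𝕜] G, IsStrictContraction (M + U ∘ₗ K ∘ₗ V)) ↔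
      (∀ y ∈ (LinearMap.adjoint U).ker, y ≠ 0 → ‖LinearMap.adjoint M y‖ < ‖y‖) ∧
        ∀ x ∈ V.ker, x ≠ 0 → ‖M x‖ < ‖x‖ := by
  constructor
  · rintro ⟨K, hK⟩
    refine ⟨fun y hyU hy => ?_, fun x hxV hx => ?_⟩
    · have hKy := hK.adjoint y hy
      rw [map_add, LinearMap.adjoint_comp] at hKy
      simpa [LinearMap.mem_ker.mp hyU] using hKy
    · simpa [LinearMap.mem_ker.mp hxV] using hK x hx
  · rintro ⟨hU, hV⟩
    obtain ⟨T, hT, hTV, hTU⟩ := exists_isStrictContraction_extension hV hU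
    obtain ⟨K, hK⟩ := exists_comp_comp_eq (T - M) U V
      (by
        rw [← LinearMap.adjoint_adjoint U, ← LinearMap.orthogonal_ker]
        rintro _ ⟨x, rfl⟩
        exact hTU x)
      (fun x hx => by simpa [sub_eq_zero] using hTV x hx)
    exact ⟨K, by rwa [hK, add_sub_cancel]⟩

end Parrott

open Matrix

open scoped Matrix.Norms.L2Operator

section Elimination

variable {𝕜 : Type*} [RCLike 𝕜]

theorem norm_lt_one_iff_isStrictContraction {α ι : Type*} [Fintype α] [Fintype ι] [DecidableEq ι]
    {A : Matrix α ι 𝕜} : ‖A‖ < 1 ↔ IsStrictContraction (toEuclideanLin A) := by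
  rw [l2_opNorm_def]
  exact norm_toContinuousLinearMap_lt_one_iff

/-- The columns of `N` form a basis of the kernel of `T`. This is how the outer factors `B_⊥` and
`C_⊥*` of the paper enter. -/
structure IsKernelBasis {κ α ρ : Type*} [Fintype α] [Fintype ρ] (N : Matrix α ρ 𝕜)
    (T : Matrix κ α 𝕜) : Prop where
  injective : Function.Injective N.mulVecLin
  range_eq : N.mulVecLin.range = T.mulVecLin.ker

theorem star_dotProduct_gram {ι κ : Type*} [Fintype ι] [Fintype κ] (G : Matrix κ ι 𝕜)
    (x : ι → 𝕜) :
    star x ⬝ᵥ ((Gᴴ * G) *ᵥ x) = ((‖WithLp.toLp 2 (G *ᵥ x)‖ ^ 2 : ℝ) : 𝕜) := by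
  rw [← mulVec_mulVec, dotProduct_mulVec, ← star_mulVec, dotProduct_comm,
    ← EuclideanSpace.inner_toLp_toLp, inner_self_eq_norm_sq_to_K, RCLike.ofReal_pow]

theorem posDef_gram_sub_gram_iff {ι κ μ : Type*} [Fintype ι] [Fintype κ] [Fintype μ]
    {G : Matrix κ ι 𝕜} {H : Matrix μ ι 𝕜} :
    (Gᴴ * G - Hᴴ * H).PosDef ↔
      ∀ x : ι → 𝕜, x ≠ 0 → ‖WithLp.toLp 2 (H *ᵥ x)‖ < ‖WithLp.toLp 2 (G *ᵥ x)‖ := by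
  have hform (x : ι → 𝕜) : 0 < star x ⬝ᵥ ((Gᴴ * G - Hᴴ * H) *ᵥ x) ↔
      ‖WithLp.toLp 2 (H *ᵥ x)‖ < ‖WithLp.toLp 2 (G *ᵥ x)‖ := by
    rw [sub_mulVec, dotProduct_sub, star_dotProduct_gram, star_dotProduct_gram, sub_pos,
      RCLike.ofReal_lt_ofReal]
    exact pow_lt_pow_iff_left₀ (norm_nonneg _) (norm_nonneg _) two_ne_zero
  rw [posDef_iff_dotProduct_mulVec]
  constructor
  · rintro ⟨-, h⟩ x hx
    exact (hform x).mp (h hx)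
  · intro h
    exact ⟨(isHermitian_conjTranspose_mul_self _).sub (isHermitian_conjTranspose_mul_self _),
      fun x hx => (hform x).mpr (h x hx)⟩

theorem isKernelBasis_iff {κ α ρ : Type*} [Fintype α] [Fintype ρ] {N : Matrix α ρ 𝕜}
    {T : Matrix κ α 𝕜} :
    IsKernelBasis N T ↔
      (∀ y, N *ᵥ y = 0 → y = 0) ∧ ∀ x, T *ᵥ x = 0 ↔ ∃ y, N *ᵥ y = x := by
  have hker : N.mulVecLin.range = T.mulVecLin.ker ↔ ∀ x, T *ᵥ x = 0 ↔ ∃ y, N *ᵥ y = x := by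
    rw [SetLike.ext_iff]
    exact forall_congr' fun x => Iff.comm
  rw [← hker]
  exact ⟨fun h => ⟨(injective_iff_map_eq_zero _).mp h.injective, h.range_eq⟩,
    fun h => ⟨(injective_iff_map_eq_zero _).mpr h.1, h.2⟩⟩

namespace IsKernelBasis

variable {κ α ρ : Type*} [Fintype α] [Fintype ρ] {N : Matrix α ρ 𝕜} {T : Matrix κ α 𝕜}

theorem forall_ker_norm_lt_iff_posDef [DecidableEq α] {β : Type*} [Fintype β]
    (h : IsKernelBasis N T) (M : Matrix β α 𝕜) :
    (∀ x ∈ (toEuclideanLin T).ker, x ≠ 0 → ‖toEuclideanLin M x‖ < ‖x‖) ↔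
      (Nᴴ * N - (M * N)ᴴ * (M * N)).PosDef := by
  obtain ⟨hN, hT⟩ := isKernelBasis_iff.mp h
  rw [posDef_gram_sub_gram_iff]
  constructor
  · intro hM y hy
    have hNy : WithLp.toLp 2 (N *ᵥ y) ∈ (toEuclideanLin T).ker := by
      rw [LinearMap.mem_ker, toLpLin_toLp, toLin'_apply, (hT _).mpr ⟨y, rfl⟩, WithLp.toLp_zero]
    have := hM _ hNy (by simpa using mt (hN y) hy)
    rw [← mulVec_mulVec]
    exact this
  · intro hM x hx hx0
    obtain ⟨y, hy⟩ := (hT _).mp (congrArg WithLp.ofLp (LinearMap.mem_ker.mp hx))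
    have hy0 : y ≠ 0 := by
      rintro rfl
      exact hx0 (by simpa using hy.symm)
    have := hM y hy0
    rw [← mulVec_mulVec, hy] at this
    exact this

theorem conj [DecidableEq α] (h : IsKernelBasis N T) {R S : Matrix α α 𝕜} (hRS : R * S = 1) :
    IsKernelBasis (S * N) (T * R) := by
  have hSR : S * R = 1 := mul_eq_one_comm.mp hRS
  rw [isKernelBasis_iff] at h ⊢
  obtain ⟨hN, hT⟩ := h
  simp only [← mulVec_mulVec]
  refine ⟨fun y hy => hN y ?_, fun x => (hT _).trans (exists_congr fun y => ⟨fun hy => ?_, ?_⟩)⟩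
  · rw [← one_mulVec (N *ᵥ y), ← hRS, ← mulVec_mulVec, hy, mulVec_zero]
  · rw [hy, mulVec_mulVec, hSR, one_mulVec]
  · rintro rfl
    rw [mulVec_mulVec, hRS, one_mulVec]

theorem fromRows_zero (β : Type*) [Fintype β] [DecidableEq β] (h : IsKernelBasis N T) :
    IsKernelBasis (fromRows N (0 : Matrix β ρ 𝕜)) (fromBlocks 0 (1 : Matrix β β 𝕜) T 0) := by
  rw [isKernelBasis_iff] at h ⊢
  obtain ⟨hN, hT⟩ := h
  simp only [fromRows_mulVec, fromBlocks_mulVec, zero_mulVec, one_mulVec, zero_add, add_zero,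
    ← Sum.elim_zero_zero, Sum.elim_eq_iff]
  refine ⟨fun y hy => hN y hy.1, fun x => ?_⟩
  rw [hT, and_comm, ← exists_and_right]
  refine exists_congr fun y => ?_
  rw [eq_comm (b := x), ← Sum.elim_comp_inl_inr x, Sum.elim_eq_iff, Sum.elim_comp_inl,
    Sum.elim_comp_inr, eq_comm (b := N *ᵥ y)]

end IsKernelBasis

variable {α γ ι κ ρ σ : Type*} [Fintype α] [Fintype γ] [Fintype ι] [Fintype κ] [Fintype ρ]
  [Fintype σ] [DecidableEq ι]

theorem exists_norm_add_mul_mul_lt_one_iff (M : Matrix α ι 𝕜) {U : Matrix α γ 𝕜}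
    {V : Matrix κ ι 𝕜} {N : Matrix α ρ 𝕜} {W : Matrix ι σ 𝕜} (hN : IsKernelBasis N Uᴴ)
    (hW : IsKernelBasis W V) :
    (∃ K : Matrix γ κ 𝕜, ‖M + U * K * V‖ < 1) ↔
      (Nᴴ * N - (Mᴴ * N)ᴴ * (Mᴴ * N)).PosDef ∧ (Wᴴ * W - (M * W)ᴴ * (M * W)).PosDef := by
  classical
  rw [← hN.forall_ker_norm_lt_iff_posDef, ← hW.forall_ker_norm_lt_iff_posDef,
    toEuclideanLin_conjTranspose_eq_adjoint, toEuclideanLin_conjTranspose_eq_adjoint,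
    ← exists_isStrictContraction_add_comp_iff]
  refine toEuclideanLin.toEquiv.exists_congr fun K => ?_
  rw [norm_lt_one_iff_isStrictContraction, map_add, toLpLin_mul (q := 2), toLpLin_mul (q := 2)]
  rfl

/-- The pair of Stein inequalities for `A`, compressed by the outer factors `N` and `W`, that
characterises stabilizability (through `N`, `Y`) and detectability (through `W`, `X`). -/
def CompressedSteinInequalities {α ρ σ : Type*} [Fintype α] (A : Matrix α α 𝕜)
    (N : Matrix α ρ 𝕜) (W : Matrix α σ 𝕜) (X Y : Matrix α α 𝕜) : Prop :=
  (Nᴴ * Y * N - Nᴴ * A * Y * Aᴴ * N).PosDef ∧ (Wᴴ * X * W - Wᴴ * Aᴴ * X * A * W).PosDef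

theorem exists_norm_conj_add_mul_mul_lt_one_iff {A : Matrix ι ι 𝕜} {U : Matrix ι γ 𝕜}
    {V : Matrix κ ι 𝕜} {N : Matrix ι ρ 𝕜} {W : Matrix ι σ 𝕜} (hN : IsKernelBasis N Uᴴ)
    (hW : IsKernelBasis W V) {Q : Matrix ι ι 𝕜} (hQ : IsUnit Q) :
    (∃ K : Matrix γ κ 𝕜, ‖Q⁻¹ * (A + U * K * V) * Q‖ < 1) ↔
      CompressedSteinInequalities A N W (Q * Qᴴ)⁻¹ (Q * Qᴴ) := by
  have hQQ : Q * Q⁻¹ = 1 := mul_nonsing_inv Q (Q.isUnit_iff_isUnit_det.mp hQ)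
  have hQQ' : (Q⁻¹)ᴴ * Qᴴ = 1 := by rw [← conjTranspose_mul, hQQ, conjTranspose_one]
  have hN' : IsKernelBasis (Qᴴ * N) (Q⁻¹ * U)ᴴ := by
    rw [conjTranspose_mul]
    exact hN.conj hQQ'
  have hgain (K : Matrix γ κ 𝕜) :
      Q⁻¹ * (A + U * K * V) * Q = Q⁻¹ * A * Q + Q⁻¹ * U * K * (V * Q) := by
    simp only [Matrix.mul_add, Matrix.add_mul, Matrix.mul_assoc]
  have hN_cancel : (Q⁻¹ * A * Q)ᴴ * (Qᴴ * N) = Qᴴ * (Aᴴ * N) := by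
    simp only [conjTranspose_mul, Matrix.mul_assoc]
    rw [← Matrix.mul_assoc (Q⁻¹)ᴴ, hQQ', Matrix.one_mul]
  have hW_cancel : Q⁻¹ * A * Q * (Q⁻¹ * W) = Q⁻¹ * (A * W) := by
    simp only [Matrix.mul_assoc]
    rw [← Matrix.mul_assoc Q, hQQ, Matrix.one_mul]
  simp only [hgain]
  rw [exists_norm_add_mul_mul_lt_one_iff _ hN' (hW.conj hQQ), hN_cancel, hW_cancel]
  simp only [CompressedSteinInequalities, Matrix.mul_inv_rev, ← conjTranspose_nonsing_inv,
    conjTranspose_mul, conjTranspose_conjTranspose, Matrix.mul_assoc]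

theorem conjTranspose_fromRows_zero_mul_mul_fromRows_zero {α β ρ : Type*} [Fintype α]
    [Fintype β] (P : Matrix (α ⊕ β) (α ⊕ β) 𝕜) (N : Matrix α ρ 𝕜) :
    (fromRows N (0 : Matrix β ρ 𝕜))ᴴ * P * fromRows N (0 : Matrix β ρ 𝕜) =
      Nᴴ * P.toBlocks₁₁ * N := by
  conv_lhs => rw [← fromBlocks_toBlocks P]
  simp [conjTranspose_fromRows_eq_fromCols_conjTranspose, fromCols_mul_fromBlocks,
    fromCols_mul_fromRows]

theorem compressedSteinInequalities_fromBlocks_zero_iff {α β ρ σ : Type*} [Fintype α]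
    [Fintype β] {A : Matrix α α 𝕜} {N : Matrix α ρ 𝕜} {W : Matrix α σ 𝕜}
    {X Y : Matrix (α ⊕ β) (α ⊕ β) 𝕜} :
    CompressedSteinInequalities (fromBlocks A 0 0 0) (fromRows N 0) (fromRows W 0) X Y ↔
      CompressedSteinInequalities A N W X.toBlocks₁₁ Y.toBlocks₁₁ := by
  set A' : Matrix (α ⊕ β) (α ⊕ β) 𝕜 := fromBlocks A 0 0 0 with hA'
  set N' : Matrix (α ⊕ β) ρ 𝕜 := fromRows N 0 with hN'
  set W' : Matrix (α ⊕ β) σ 𝕜 := fromRows W 0 with hW'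
  have hAN : A'ᴴ * N' = fromRows (Aᴴ * N) 0 := by
    simp [hA', hN', fromBlocks_conjTranspose, fromBlocks_mul_fromRows]
  have hAW : A' * W' = fromRows (A * W) 0 := by
    simp [hA', hW', fromBlocks_mul_fromRows]
  have hY : N'ᴴ * A' * Y * A'ᴴ * N' = Nᴴ * A * Y.toBlocks₁₁ * Aᴴ * N := by
    have := conjTranspose_fromRows_zero_mul_mul_fromRows_zero Y (Aᴴ * N)
    simpa only [← hAN, conjTranspose_mul, conjTranspose_conjTranspose, Matrix.mul_assoc] using this
  have hX : W'ᴴ * A'ᴴ * X * A' * W' = Wᴴ * Aᴴ * X.toBlocks₁₁ * A * W := by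
    have := conjTranspose_fromRows_zero_mul_mul_fromRows_zero X (A * W)
    simpa only [← hAW, conjTranspose_mul, Matrix.mul_assoc] using this
  rw [CompressedSteinInequalities, hY, hX, hN', hW',
    conjTranspose_fromRows_zero_mul_mul_fromRows_zero,
    conjTranspose_fromRows_zero_mul_mul_fromRows_zero, CompressedSteinInequalities]

/-- The closed-loop state matrix as an affine function of the gain `K`, for a plant without
feedthrough whose state is extended by the controller state. -/
def feedback {α β γ κ : Type*} [Fintype β] [DecidableEq β] [Fintype γ] [Fintype κ]
    (A : Matrix α α 𝕜) (B : Matrix α γ 𝕜) (C : Matrix κ α 𝕜) (K : Matrix (β ⊕ γ) (β ⊕ κ) 𝕜) :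
    Matrix (α ⊕ β) (α ⊕ β) 𝕜 :=
  fromBlocks A 0 0 0 + (fromBlocks 0 B 1 0 : Matrix (α ⊕ β) (β ⊕ γ) 𝕜) * K *
    (fromBlocks 0 1 C 0 : Matrix (β ⊕ κ) (α ⊕ β) 𝕜)

theorem exists_norm_feedback_lt_one_iff {α β γ κ ρ σ : Type*} [Fintype α] [DecidableEq α]
    [Fintype β] [DecidableEq β] [Fintype γ] [Fintype κ] [Fintype ρ] [Fintype σ]
    (A : Matrix α α 𝕜) {B : Matrix α γ 𝕜} {C : Matrix κ α 𝕜} {N : Matrix α ρ 𝕜}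
    {W : Matrix α σ 𝕜} (hN : IsKernelBasis N Bᴴ) (hW : IsKernelBasis W C)
    {Q : Matrix (α ⊕ β) (α ⊕ β) 𝕜} (hQ : IsUnit Q) :
    (∃ K, ‖Q⁻¹ * feedback A B C K * Q‖ < 1) ↔
      CompressedSteinInequalities A N W (Q * Qᴴ)⁻¹.toBlocks₁₁ (Q * Qᴴ).toBlocks₁₁ := by
  have hN' : IsKernelBasis (fromRows N (0 : Matrix β ρ 𝕜))
      (fromBlocks 0 B 1 0 : Matrix (α ⊕ β) (β ⊕ γ) 𝕜)ᴴ := by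
    convert hN.fromRows_zero β using 1
    simp [fromBlocks_conjTranspose]
  rw [← compressedSteinInequalities_fromBlocks_zero_iff,
    ← exists_norm_conj_add_mul_mul_lt_one_iff hN' (hW.fromRows_zero β) hQ]
  rfl

end Elimination

section Coupling

open scoped MatrixOrder

theorem exists_linearIsometry_of_finrank_le {𝕜 E F : Type*} [RCLike 𝕜] [NormedAddCommGroup E]
    [InnerProductSpace 𝕜 E] [FiniteDimensional 𝕜 E] [NormedAddCommGroup F]
    [InnerProductSpace 𝕜 F] [FiniteDimensional 𝕜 F]
    (h : Module.finrank 𝕜 E ≤ Module.finrank 𝕜 F) : Nonempty (E →ₗᵢ[𝕜] F) := by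
  let b := stdOrthonormalBasis 𝕜 E
  let c := stdOrthonormalBasis 𝕜 F
  let J : E →ₗ[𝕜] F := b.toBasis.constr 𝕜 (c ∘ Fin.castLE h)
  refine ⟨J.isometryOfOrthonormal (v := b.toBasis) (by simp [b.orthonormal]) ?_⟩
  have hJ : J ∘ b.toBasis = c ∘ Fin.castLE h := funext fun i => b.toBasis.constr_basis 𝕜 _ i
  rw [hJ]
  exact c.orthonormal.comp _ (Fin.castLE_injective h)

theorem exists_inner_map_map_eq_of_finrank_range_le {𝕜 E F G : Type*} [RCLike 𝕜]
    [NormedAddCommGroup E] [InnerProductSpace 𝕜 E] [NormedAddCommGroup F]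
    [InnerProductSpace 𝕜 F] [FiniteDimensional 𝕜 F] [NormedAddCommGroup G]
    [InnerProductSpace 𝕜 G] [FiniteDimensional 𝕜 G] (f : E →ₗ[𝕜] F)
    (h : Module.finrank 𝕜 f.range ≤ Module.finrank 𝕜 G) :
    ∃ g : E →ₗ[𝕜] G, ∀ x y, inner 𝕜 (g x) (g y) = inner 𝕜 (f x) (f y) := by
  obtain ⟨J⟩ := exists_linearIsometry_of_finrank_le h
  exact ⟨J.toLinearMap ∘ₗ f.rangeRestrict, fun x y => J.inner_map_map _ _⟩

theorem exists_conjTranspose_mul_self_eq_of_rank_le {𝕜 ι ρ : Type*} [RCLike 𝕜] [Fintype ι]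
    [Fintype ρ] {A : Matrix ι ι 𝕜} (hA : A.PosSemidef) (hrank : A.rank ≤ Fintype.card ρ) :
    ∃ H : Matrix ρ ι 𝕜, Hᴴ * H = A := by
  classical
  obtain ⟨B, rfl⟩ := CStarAlgebra.nonneg_iff_eq_star_mul_self.mp hA.nonneg
  have hfinrank : Module.finrank 𝕜 (toEuclideanLin B).range ≤
      Module.finrank 𝕜 (EuclideanSpace 𝕜 ρ) := by
    rwa [finrank_euclideanSpace, toEuclideanLin_eq_toLin_orthonormal,
      ← rank_eq_finrank_range_toLin, ← rank_conjTranspose_mul_self]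
  obtain ⟨L, hL⟩ := exists_inner_map_map_eq_of_finrank_range_le (toEuclideanLin B) hfinrank
  refine ⟨toEuclideanLin.symm L, toEuclideanLin.injective (LinearMap.ext fun x =>
    ext_inner_left 𝕜 fun y => ?_)⟩
  rw [star_eq_conjTranspose, toLpLin_mul (q := 2), toLpLin_mul (q := 2),
    toEuclideanLin_conjTranspose_eq_adjoint, toEuclideanLin_conjTranspose_eq_adjoint,
    LinearEquiv.apply_symm_apply, LinearMap.comp_apply, LinearMap.comp_apply,
    LinearMap.adjoint_inner_right, LinearMap.adjoint_inner_right, hL]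

theorem exists_complementary_pair {K E F G : Type*} [Field K] [AddCommGroup E] [Module K E]
    [FiniteDimensional K E] [AddCommGroup F] [Module K F] [AddCommGroup G] [Module K G]
    [FiniteDimensional K G] {t : E →ₗ[K] F} {h : F →ₗ[K] E}
    (hth : t ∘ₗ h = LinearMap.id)
    (hfinrank : Module.finrank K E = Module.finrank K F + Module.finrank K G) :
    ∃ (t' : E →ₗ[K] G) (z : G →ₗ[K] E), t ∘ₗ z = 0 ∧ t' ∘ₗ h = 0 ∧ t' ∘ₗ z = LinearMap.id := by
  have hth_apply (x : F) : t (h x) = x := LinearMap.congr_fun hth x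
  have hker : Module.finrank K t.ker = Module.finrank K G := by
    have := t.finrank_range_add_finrank_ker
    rw [LinearMap.range_eq_top.mpr fun x => ⟨h x, hth_apply x⟩, finrank_top] at this
    omega
  let e : t.ker ≃ₗ[K] G := LinearEquiv.ofFinrankEq _ _ hker
  let p : E →ₗ[K] t.ker :=
    (LinearMap.id - h ∘ₗ t).codRestrict _ fun x => by simp [hth_apply]
  have hp_ker (x : t.ker) : p x = x := Subtype.ext <| by simp [p]
  have hp_range (x : F) : p (h x) = 0 := Subtype.ext <| by simp [p, hth_apply]
  refine ⟨e.toLinearMap ∘ₗ p, t.ker.subtype ∘ₗ e.symm.toLinearMap, ?_, ?_, ?_⟩ <;> ext x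
  · simp
  · simp [hp_range]
  · simp [hp_ker]

theorem exists_fromRows_mul_fromCols_eq_one {K α β ι : Type*} [Field K] [Fintype α]
    [DecidableEq α] [Fintype β] [DecidableEq β] [Fintype ι] {T : Matrix α ι K}
    {H : Matrix ι α K} (hTH : T * H = 1)
    (hcard : Fintype.card ι = Fintype.card α + Fintype.card β) :
    ∃ (T' : Matrix β ι K) (Z : Matrix ι β K), fromRows T T' * fromCols H Z = 1 := by
  classical
  have hTH_lin : toLin' T ∘ₗ toLin' H = LinearMap.id := by rw [← toLin'_mul, hTH, toLin'_one]
  obtain ⟨t', z, htz, ht'h, ht'z⟩ :=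
    exists_complementary_pair (G := β → K) hTH_lin (by simpa using hcard)
  refine ⟨LinearMap.toMatrix' t', LinearMap.toMatrix' z, ?_⟩
  rw [fromRows_mul_fromCols, ← fromBlocks_one, fromBlocks_inj]
  refine ⟨hTH, ?_, ?_, ?_⟩ <;> apply toLin'.injective <;> simpa [toLin'_mul]

variable {𝕜 α β : Type*} [RCLike 𝕜] [Fintype α] [DecidableEq α] [Fintype β] [DecidableEq β]

theorem fromBlocks_toBlocks₁₁_eq_gram {R S : Matrix (α ⊕ β) (α ⊕ β) 𝕜} (hRS : R * S = 1) :
    fromBlocks (Sᴴ * S).toBlocks₁₁ 1 1 (R * Rᴴ).toBlocks₁₁ =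
      (fromCols S.toCols₁ R.toRows₁ᴴ)ᴴ * fromCols S.toCols₁ R.toRows₁ᴴ := by
  have hRS' : Sᴴ * Rᴴ = 1 := by rw [← conjTranspose_mul, hRS, conjTranspose_one]
  rw [conjTranspose_fromCols_eq_fromRows_conjTranspose, fromRows_mul_fromCols]
  have hoffdiag {M : Matrix (α ⊕ β) (α ⊕ β) 𝕜} (hM : M = 1) : M.toBlocks₁₁ = 1 := by
    rw [hM, ← fromBlocks_one, toBlocks_fromBlocks₁₁]
  rw [conjTranspose_conjTranspose, fromBlocks_inj]
  exact ⟨rfl, (hoffdiag hRS').symm, (hoffdiag hRS).symm, rfl⟩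

theorem posSemidef_and_rank_le_iff_exists_isUnit {X Y : Matrix α α 𝕜} :
    ((fromBlocks X 1 1 Y).PosSemidef ∧
        (fromBlocks X 1 1 Y).rank ≤ Fintype.card α + Fintype.card β) ↔
      ∃ Q : Matrix (α ⊕ β) (α ⊕ β) 𝕜,
        IsUnit Q ∧ X = ((Q * Qᴴ)⁻¹).toBlocks₁₁ ∧ Y = (Q * Qᴴ).toBlocks₁₁ := by
  rw [← Fintype.card_sum]
  constructor
  · rintro ⟨hpsd, hrank⟩
    obtain ⟨H, hH⟩ := exists_conjTranspose_mul_self_eq_of_rank_le hpsd hrank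
    rw [← fromCols_toCols H, conjTranspose_fromCols_eq_fromRows_conjTranspose,
      fromRows_mul_fromCols, fromBlocks_inj] at hH
    obtain ⟨hX, -, hYX, hY⟩ := hH
    obtain ⟨T, Z, hTZ⟩ := exists_fromRows_mul_fromCols_eq_one (β := β) hYX Fintype.card_sum
    refine ⟨_, IsUnit.of_mul_eq_one _ hTZ, ?_, ?_⟩
    · rw [Matrix.mul_inv_rev, ← conjTranspose_nonsing_inv, inv_eq_right_inv hTZ, ← hX,
        conjTranspose_fromCols_eq_fromRows_conjTranspose, fromRows_mul_fromCols,
        toBlocks_fromBlocks₁₁]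
    · rw [conjTranspose_fromRows_eq_fromCols_conjTranspose, fromRows_mul_fromCols,
        toBlocks_fromBlocks₁₁, conjTranspose_conjTranspose, hY]
  · rintro ⟨Q, hQ, rfl, rfl⟩
    have hQQ : Q * Q⁻¹ = 1 := mul_nonsing_inv Q (Q.isUnit_iff_isUnit_det.mp hQ)
    rw [Matrix.mul_inv_rev, ← conjTranspose_nonsing_inv, fromBlocks_toBlocks₁₁_eq_gram hQQ]
    refine ⟨posSemidef_conjTranspose_mul_self _, ?_⟩
    rw [rank_conjTranspose_mul_self]
    exact rank_le_card_height _

end Coupling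

section Commutant

open scoped Kronecker

variable {𝕜 : Type*} [RCLike 𝕜] {d : ℕ} {m : Fin d → ℕ}

/-- The rectangular analogue `diag(I_{m₁} ⊗ R₁, …, I_{m_d} ⊗ R_d)` of `repeatedBlocks`, with which
it agrees when `a = b`. -/
def repeatedRectBlocks (m : Fin d → ℕ) {a b : Fin d → ℕ}
    (R : ∀ k, Matrix (Fin (a k)) (Fin (b k)) 𝕜) : Matrix (StateIdx m a) (StateIdx m b) 𝕜 :=
  blockDiagonal' fun k => (1 : Matrix (Fin (m k)) (Fin (m k)) 𝕜) ⊗ₖ R k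

section RepeatedRectBlocks

variable {a b c : Fin d → ℕ}

theorem repeatedRectBlocks_apply_same (R : ∀ k, Matrix (Fin (a k)) (Fin (b k)) 𝕜) (k : Fin d)
    (i : Fin (m k)) (p : Fin (a k)) (q : Fin (b k)) :
    repeatedRectBlocks m R ⟨k, i, p⟩ ⟨k, i, q⟩ = R k p q := by
  simp [repeatedRectBlocks, blockDiagonal'_apply_eq]

theorem repeatedRectBlocks_add (R S : ∀ k, Matrix (Fin (a k)) (Fin (b k)) 𝕜) :
    repeatedRectBlocks m R + repeatedRectBlocks m S = repeatedRectBlocks m (R + S) := by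
  simp only [repeatedRectBlocks, ← blockDiagonal'_add, Pi.add_apply, kronecker_add]
  rfl

theorem repeatedRectBlocks_mul (R : ∀ k, Matrix (Fin (a k)) (Fin (b k)) 𝕜)
    (S : ∀ k, Matrix (Fin (b k)) (Fin (c k)) 𝕜) :
    repeatedRectBlocks m R * repeatedRectBlocks m S = repeatedRectBlocks m fun k => R k * S k := by
  simp only [repeatedRectBlocks, ← blockDiagonal'_mul, ← mul_kronecker_mul, one_mul]

theorem repeatedRectBlocks_conjTranspose (R : ∀ k, Matrix (Fin (a k)) (Fin (b k)) 𝕜) :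
    (repeatedRectBlocks m R)ᴴ = repeatedRectBlocks m fun k => (R k)ᴴ := by
  simp only [repeatedRectBlocks, blockDiagonal'_conjTranspose, conjTranspose_kronecker,
    conjTranspose_one]

theorem repeatedRectBlocks_inj {R S : ∀ k, Matrix (Fin (a k)) (Fin (b k)) 𝕜} :
    repeatedRectBlocks m R = repeatedRectBlocks m S ↔ ∀ k, m k ≠ 0 → R k = S k := by
  constructor
  · intro h k hk
    ext p q
    rw [← repeatedRectBlocks_apply_same R k ⟨0, Nat.pos_of_ne_zero hk⟩, h,
      repeatedRectBlocks_apply_same]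
  · intro h
    refine congrArg blockDiagonal' (funext fun k => ?_)
    ext ⟨i, p⟩ ⟨j, q⟩
    rw [h k (Nat.ne_zero_of_lt i.isLt)]

theorem mul_uncertainty_apply {ι : Type*} (Z : Matrix ι (StateIdx m b) 𝕜)
    (δ : ∀ k, Matrix (Fin (m k)) (Fin (m k)) 𝕜) (x : ι) (k : Fin d) (j : Fin (m k))
    (q : Fin (b k)) :
    (Z * uncertainty b δ) x ⟨k, j, q⟩ = ∑ i, Z x ⟨k, i, q⟩ * δ k i j := by
  rw [mul_apply, Fintype.sum_sigma, Fintype.sum_eq_single k fun l hl => by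
    simp [uncertainty, blockDiagonal'_apply_ne _ _ _ hl], Fintype.sum_prod_type]
  simp [uncertainty, blockDiagonal'_apply_eq, one_apply]

theorem uncertainty_mul_apply {ι : Type*} (Z : Matrix (StateIdx m a) ι 𝕜)
    (δ : ∀ k, Matrix (Fin (m k)) (Fin (m k)) 𝕜) (k : Fin d) (i : Fin (m k)) (p : Fin (a k))
    (y : ι) :
    (uncertainty a δ * Z) ⟨k, i, p⟩ y = ∑ j, δ k i j * Z ⟨k, j, p⟩ y := by
  rw [mul_apply, Fintype.sum_sigma, Fintype.sum_eq_single k fun l hl => by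
    simp [uncertainty, blockDiagonal'_apply_ne _ _ _ hl.symm], Fintype.sum_prod_type]
  simp [uncertainty, blockDiagonal'_apply_eq, one_apply]

theorem repeatedRectBlocks_mul_uncertainty (R : ∀ k, Matrix (Fin (a k)) (Fin (b k)) 𝕜)
    (δ : ∀ k, Matrix (Fin (m k)) (Fin (m k)) 𝕜) :
    repeatedRectBlocks m R * uncertainty b δ = uncertainty a δ * repeatedRectBlocks m R := by
  simp only [repeatedRectBlocks, uncertainty, ← blockDiagonal'_mul, ← mul_kronecker_mul,
    Matrix.one_mul, Matrix.mul_one]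

section Intertwiner

variable {Z : Matrix (StateIdx m a) (StateIdx m b) 𝕜}
  (hZ : ∀ δ : ∀ k, Matrix (Fin (m k)) (Fin (m k)) 𝕜, Z * uncertainty b δ = uncertainty a δ * Z)

include hZ

theorem sum_mul_eq_sum_mul_of_intertwines (δ : ∀ k, Matrix (Fin (m k)) (Fin (m k)) 𝕜)
    {k l : Fin d} (i : Fin (m k)) (p : Fin (a k)) (j : Fin (m l)) (q : Fin (b l)) :
    ∑ j', Z ⟨k, i, p⟩ ⟨l, j', q⟩ * δ l j' j = ∑ i', δ k i i' * Z ⟨k, i', p⟩ ⟨l, j, q⟩ := by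
  rw [← mul_uncertainty_apply, hZ, uncertainty_mul_apply]

theorem apply_eq_zero_of_intertwines {k l : Fin d} (hkl : k ≠ l) (i : Fin (m k)) (p : Fin (a k))
    (j : Fin (m l)) (q : Fin (b l)) : Z ⟨k, i, p⟩ ⟨l, j, q⟩ = 0 := by
  have h := sum_mul_eq_sum_mul_of_intertwines hZ (Pi.single l 1) i p j q
  simpa [hkl, one_apply] using h

theorem apply_eq_ite_of_intertwines {k : Fin d} (i j j' : Fin (m k)) (p : Fin (a k))
    (q : Fin (b k)) :
    Z ⟨k, i, p⟩ ⟨k, j, q⟩ = if i = j then Z ⟨k, j', p⟩ ⟨k, j', q⟩ else 0 := by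
  have h := sum_mul_eq_sum_mul_of_intertwines hZ (Pi.single k (single j j' 1)) i p j' q
  simpa [single_apply, eq_comm, ite_and] using h

end Intertwiner

theorem intertwines_uncertainty_iff {Z : Matrix (StateIdx m a) (StateIdx m b) 𝕜} :
    (∀ δ : ∀ k, Matrix (Fin (m k)) (Fin (m k)) 𝕜, Z * uncertainty b δ = uncertainty a δ * Z) ↔
      ∃ R, Z = repeatedRectBlocks m R := by
  constructor
  · intro hZ
    have hblock (k : Fin d) : ∃ Rk : Matrix (Fin (a k)) (Fin (b k)) 𝕜,
        ∀ i j p q, Z ⟨k, i, p⟩ ⟨k, j, q⟩ = if i = j then Rk p q else 0 := by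
      rcases isEmpty_or_nonempty (Fin (m k)) with hm | ⟨⟨j'⟩⟩
      · exact ⟨0, fun i => hm.elim i⟩
      · exact ⟨of fun p q => Z ⟨k, j', p⟩ ⟨k, j', q⟩,
          fun i j p q => apply_eq_ite_of_intertwines hZ i j j' p q⟩
    choose R hR using hblock
    refine ⟨R, ?_⟩
    ext ⟨k, i, p⟩ ⟨l, j, q⟩
    rcases eq_or_ne k l with rfl | hkl
    · simp [hR, repeatedRectBlocks, blockDiagonal'_apply_eq, one_apply]
    · simp [apply_eq_zero_of_intertwines hZ hkl, repeatedRectBlocks,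
        blockDiagonal'_apply_ne _ _ _ hkl]
  · rintro ⟨R, rfl⟩ δ
    exact repeatedRectBlocks_mul_uncertainty R δ

end RepeatedRectBlocks

section ClosedLoopBlocks

variable {n nK : Fin d → ℕ}

/-- The element `[rep R₁₁, rep R₁₂; rep R₂₁, rep R₂₂]` of the commutant of the closed-loop
structure, where `rep` is `repeatedRectBlocks` and `Rᵢⱼ` is the family of the `(i, j)` blocks of
the `R k`. -/
def closedLoopBlocks (m : Fin d → ℕ)
    (R : ∀ k, Matrix (Fin (n k) ⊕ Fin (nK k)) (Fin (n k) ⊕ Fin (nK k)) 𝕜) :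
    Matrix (StateIdx m n ⊕ StateIdx m nK) (StateIdx m n ⊕ StateIdx m nK) 𝕜 :=
  fromBlocks (repeatedRectBlocks m fun k => (R k).toBlocks₁₁)
    (repeatedRectBlocks m fun k => (R k).toBlocks₁₂)
    (repeatedRectBlocks m fun k => (R k).toBlocks₂₁)
    (repeatedRectBlocks m fun k => (R k).toBlocks₂₂)

variable (R S : ∀ k, Matrix (Fin (n k) ⊕ Fin (nK k)) (Fin (n k) ⊕ Fin (nK k)) 𝕜)

theorem closedLoopBlocks_mul :
    closedLoopBlocks m R * closedLoopBlocks m S = closedLoopBlocks m (R * S) := by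
  have hmul (k : Fin d) : R k * S k =
      fromBlocks ((R k).toBlocks₁₁ * (S k).toBlocks₁₁ + (R k).toBlocks₁₂ * (S k).toBlocks₂₁)
        ((R k).toBlocks₁₁ * (S k).toBlocks₁₂ + (R k).toBlocks₁₂ * (S k).toBlocks₂₂)
        ((R k).toBlocks₂₁ * (S k).toBlocks₁₁ + (R k).toBlocks₂₂ * (S k).toBlocks₂₁)
        ((R k).toBlocks₂₁ * (S k).toBlocks₁₂ + (R k).toBlocks₂₂ * (S k).toBlocks₂₂) := by
    rw [← fromBlocks_multiply, fromBlocks_toBlocks, fromBlocks_toBlocks]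
  simp only [closedLoopBlocks, fromBlocks_multiply, repeatedRectBlocks_mul,
    repeatedRectBlocks_add, Pi.mul_apply, hmul, toBlocks_fromBlocks₁₁, toBlocks_fromBlocks₁₂,
    toBlocks_fromBlocks₂₁, toBlocks_fromBlocks₂₂]
  rfl

theorem closedLoopBlocks_conjTranspose :
    (closedLoopBlocks m R)ᴴ = closedLoopBlocks m fun k => (R k)ᴴ := by
  simp only [closedLoopBlocks, fromBlocks_conjTranspose, repeatedRectBlocks_conjTranspose]
  rfl

theorem toBlocks₁₁_closedLoopBlocks_gram :
    (closedLoopBlocks m R * (closedLoopBlocks m R)ᴴ).toBlocks₁₁ =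
      repeatedBlocks m fun k => (R k * (R k)ᴴ).toBlocks₁₁ := by
  rw [closedLoopBlocks_conjTranspose, closedLoopBlocks_mul]
  rfl

theorem closedLoopBlocks_one :
    closedLoopBlocks m
      (1 : ∀ k, Matrix (Fin (n k) ⊕ Fin (nK k)) (Fin (n k) ⊕ Fin (nK k)) 𝕜) = 1 := by
  simp only [closedLoopBlocks, repeatedRectBlocks, Pi.one_apply, ← fromBlocks_one,
    toBlocks_fromBlocks₁₁, toBlocks_fromBlocks₁₂, toBlocks_fromBlocks₂₁, toBlocks_fromBlocks₂₂,
    kronecker_zero]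
  simp only [one_kronecker_one]
  rw [fromBlocks_inj]
  exact ⟨blockDiagonal'_one, blockDiagonal'_zero, blockDiagonal'_zero, blockDiagonal'_one⟩

variable {R S}

theorem closedLoopBlocks_inj :
    closedLoopBlocks m R = closedLoopBlocks m S ↔ ∀ k, m k ≠ 0 → R k = S k := by
  rw [closedLoopBlocks, closedLoopBlocks, fromBlocks_inj]
  simp only [repeatedRectBlocks_inj, ext_iff_blocks, forall_and]

theorem closedLoopBlocks_mul_inv (hR : ∀ k, IsUnit (R k)) :
    closedLoopBlocks m R * closedLoopBlocks m (fun k => (R k)⁻¹) = 1 := by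
  rw [closedLoopBlocks_mul, ← closedLoopBlocks_one]
  congr 1
  funext k
  exact mul_nonsing_inv _ ((isUnit_iff_isUnit_det _).mp (hR k))

theorem isUnit_closedLoopBlocks (hR : ∀ k, IsUnit (R k)) : IsUnit (closedLoopBlocks m R) :=
  IsUnit.of_mul_eq_one _ (closedLoopBlocks_mul_inv hR)

theorem closedLoopBlocks_inv (hR : ∀ k, IsUnit (R k)) :
    (closedLoopBlocks m R)⁻¹ = closedLoopBlocks m fun k => (R k)⁻¹ :=
  inv_eq_right_inv (closedLoopBlocks_mul_inv hR)

theorem mem_commutant_closedLoopStructure_iff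
    {Z : Matrix (StateIdx m n ⊕ StateIdx m nK) (StateIdx m n ⊕ StateIdx m nK) 𝕜} :
    Z ∈ commutant (closedLoopStructure 𝕜 m n nK) ↔ ∃ R, Z = closedLoopBlocks m R := by
  have hcomm (δ : ∀ k, Matrix (Fin (m k)) (Fin (m k)) 𝕜) :
      Z * fromBlocks (uncertainty n δ) 0 0 (uncertainty nK δ) =
          fromBlocks (uncertainty n δ) 0 0 (uncertainty nK δ) * Z ↔
        (Z.toBlocks₁₁ * uncertainty n δ = uncertainty n δ * Z.toBlocks₁₁ ∧
          Z.toBlocks₁₂ * uncertainty nK δ = uncertainty n δ * Z.toBlocks₁₂ ∧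
          Z.toBlocks₂₁ * uncertainty n δ = uncertainty nK δ * Z.toBlocks₂₁ ∧
          Z.toBlocks₂₂ * uncertainty nK δ = uncertainty nK δ * Z.toBlocks₂₂) := by
    rw [← fromBlocks_toBlocks Z, fromBlocks_multiply, fromBlocks_multiply, fromBlocks_inj]
    simp
  simp only [commutant, closedLoopStructure, Set.mem_ofPred_eq, Set.forall_mem_range, hcomm,
    forall_and, intertwines_uncertainty_iff]
  constructor
  · rintro ⟨⟨R₁₁, h₁₁⟩, ⟨R₁₂, h₁₂⟩, ⟨R₂₁, h₂₁⟩, ⟨R₂₂, h₂₂⟩⟩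
    refine ⟨fun k => fromBlocks (R₁₁ k) (R₁₂ k) (R₂₁ k) (R₂₂ k), ?_⟩
    rw [← fromBlocks_toBlocks Z, h₁₁, h₁₂, h₂₁, h₂₂]
    rfl
  · rintro ⟨R, rfl⟩
    exact ⟨⟨fun k => (R k).toBlocks₁₁, rfl⟩, ⟨fun k => (R k).toBlocks₁₂, rfl⟩,
      ⟨fun k => (R k).toBlocks₂₁, rfl⟩, ⟨fun k => (R k).toBlocks₂₂, rfl⟩⟩

theorem inv_mem_commutant {ι : Type*} [Fintype ι] [DecidableEq ι] {S : Set (Matrix ι ι 𝕜)}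
    {Q : Matrix ι ι 𝕜} (hQ : Q ∈ commutant S) (hQ_unit : IsUnit Q) : Q⁻¹ ∈ commutant S := by
  obtain ⟨u, rfl⟩ := hQ_unit
  intro D hD
  rw [← coe_units_inv]
  exact Commute.units_inv_left (hQ D hD)

theorem exists_isUnit_eq_closedLoopBlocks
    {Q : Matrix (StateIdx m n ⊕ StateIdx m nK) (StateIdx m n ⊕ StateIdx m nK) 𝕜}
    (hQ : Q ∈ commutant (closedLoopStructure 𝕜 m n nK)) (hQ_unit : IsUnit Q) :
    ∃ R, (∀ k, IsUnit (R k)) ∧ Q = closedLoopBlocks m R := by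
  obtain ⟨S, hS⟩ := mem_commutant_closedLoopStructure_iff.mp (inv_mem_commutant hQ hQ_unit)
  obtain ⟨R, rfl⟩ := mem_commutant_closedLoopStructure_iff.mp hQ
  have hRS := mul_nonsing_inv _ ((isUnit_iff_isUnit_det _).mp hQ_unit)
  rw [hS, closedLoopBlocks_mul, ← closedLoopBlocks_one, closedLoopBlocks_inj] at hRS
  -- The blocks with `m k = 0` do not occur in `Q`, so they are replaced by the identity.
  refine ⟨fun k => if m k = 0 then 1 else R k, fun k => ?_,
    closedLoopBlocks_inj.mpr fun k hk => ?_⟩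
  · dsimp only
    split_ifs with hk
    · exact isUnit_one
    · exact IsUnit.of_mul_eq_one _ (hRS k hk)
  · rw [if_neg hk]

theorem toBlocks₁₁_closedLoopBlocks_gram_inv (hR : ∀ k, IsUnit (R k)) :
    (closedLoopBlocks m R * (closedLoopBlocks m R)ᴴ)⁻¹.toBlocks₁₁ =
      repeatedBlocks m fun k => (R k * (R k)ᴴ)⁻¹.toBlocks₁₁ := by
  rw [closedLoopBlocks_conjTranspose, closedLoopBlocks_mul, closedLoopBlocks_inv]
  · rfl
  · exact fun k => (hR k).mul (hR k).star

theorem repeatedBlocks_mem_commutant (X : ∀ k, Matrix (Fin (n k)) (Fin (n k)) 𝕜) :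
    repeatedBlocks m X ∈ commutant (openStructure 𝕜 m n) := by
  rintro _ ⟨δ, rfl⟩
  exact repeatedRectBlocks_mul_uncertainty X δ

theorem exists_mem_commutant_toBlocks₁₁_gram_eq_iff
    {X Y : Matrix (StateIdx m n) (StateIdx m n) 𝕜} :
    (∃ Q ∈ commutant (closedLoopStructure 𝕜 m n nK),
        IsUnit Q ∧ X = (Q * Qᴴ)⁻¹.toBlocks₁₁ ∧ Y = (Q * Qᴴ).toBlocks₁₁) ↔
      ∃ X₀ Y₀ : ∀ k, Matrix (Fin (n k)) (Fin (n k)) 𝕜,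
        X = repeatedBlocks m X₀ ∧ Y = repeatedBlocks m Y₀ ∧
          ∀ k, (fromBlocks (X₀ k) 1 1 (Y₀ k)).PosSemidef ∧
            (fromBlocks (X₀ k) 1 1 (Y₀ k)).rank ≤ n k + nK k := by
  have hcoupling (k : Fin d) (Xk Yk : Matrix (Fin (n k)) (Fin (n k)) 𝕜) :=
    posSemidef_and_rank_le_iff_exists_isUnit (β := Fin (nK k)) (X := Xk) (Y := Yk)
  simp only [Fintype.card_fin] at hcoupling
  simp only [hcoupling]
  constructor
  · rintro ⟨Q, hQ, hQ_unit, rfl, rfl⟩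
    obtain ⟨R, hR, rfl⟩ := exists_isUnit_eq_closedLoopBlocks hQ hQ_unit
    exact ⟨_, _, toBlocks₁₁_closedLoopBlocks_gram_inv hR, toBlocks₁₁_closedLoopBlocks_gram R,
      fun k => ⟨R k, hR k, rfl, rfl⟩⟩
  · rintro ⟨X₀, Y₀, rfl, rfl, h⟩
    choose R hR hX hY using h
    refine ⟨closedLoopBlocks m R, mem_commutant_closedLoopStructure_iff.mpr ⟨R, rfl⟩,
      isUnit_closedLoopBlocks hR, ?_, ?_⟩
    · rw [toBlocks₁₁_closedLoopBlocks_gram_inv hR, funext hX]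
    · rw [toBlocks₁₁_closedLoopBlocks_gram, funext hY]

end ClosedLoopBlocks

end Commutant

section WellPosedness

variable {𝕜 : Type*} [RCLike 𝕜]

theorem finite_setOf_det_one_add_smul_eq_zero {K ι : Type*} [Field K] [Fintype ι] [DecidableEq ι]
    (M : Matrix ι ι K) : {t : K | (1 + t • M).det = 0}.Finite := by
  let p : Polynomial K := (1 + (Polynomial.X : Polynomial K) • M.map Polynomial.C).det
  have hp_eval (t : K) : p.eval t = (1 + t • M).det := by
    rw [← Polynomial.coe_evalRingHom, RingHom.map_det]
    congr 1
    ext i j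
    simp [one_apply, apply_ite (Polynomial.eval t), mul_comm t]
  have hp : p ≠ 0 := by
    intro h
    simpa [h] using hp_eval 0
  simpa only [Polynomial.IsRoot, hp_eval] using Polynomial.finite_setOfPred_isRoot hp

theorem exists_one_sub_mul_inv_mul_eq {R γ κ : Type*} [CommRing R] [Fintype γ] [DecidableEq γ]
    [Fintype κ] [DecidableEq κ] {D : Matrix κ γ R} {L : Matrix γ κ R} (h : IsUnit (1 + D * L)) :
    ∃ G : Matrix γ κ R, IsUnit (1 - D * G) ∧ (1 - G * D)⁻¹ * G = L := by
  obtain ⟨G, hG⟩ : ∃ G : Matrix γ κ R, G + G * D * L = L := by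
    refine ⟨L * (1 + D * L)⁻¹, ?_⟩
    rw [Matrix.mul_assoc _ D]
    nth_rw 1 [← Matrix.mul_one (L * (1 + D * L)⁻¹)]
    rw [← Matrix.mul_add, nonsing_inv_mul_cancel_right _ _ ((isUnit_iff_isUnit_det _).mp h)]
  have hDG : IsUnit (1 - D * G) := by
    refine IsUnit.of_mul_eq_one (1 + D * L) ?_
    calc (1 - D * G) * (1 + D * L) = 1 + D * L - D * (G + G * D * L) := by
          simp only [Matrix.sub_mul, Matrix.mul_add, Matrix.mul_one, Matrix.one_mul,
            Matrix.mul_assoc]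
          abel
      _ = 1 := by rw [hG, add_sub_cancel_right]
  have hGD : IsUnit (1 - G * D).det := by
    rw [det_one_sub_mul_comm]
    exact (isUnit_iff_isUnit_det _).mp hDG
  have hGL : (1 - G * D) * L = G := by
    rw [Matrix.sub_mul, Matrix.one_mul, sub_eq_iff_eq_add, hG]
  refine ⟨G, hDG, ?_⟩
  calc (1 - G * D)⁻¹ * G = (1 - G * D)⁻¹ * ((1 - G * D) * L) := by rw [hGL]
    _ = L := nonsing_inv_mul_cancel_left _ _ hGD

theorem exists_isUnit_one_sub_mul_of_isOpen {γ κ : Type*} [Fintype γ] [DecidableEq γ]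
    [Fintype κ] [DecidableEq κ] (D : Matrix κ γ 𝕜) {U : Set (Matrix γ κ 𝕜)} (hU : IsOpen U)
    (hU_nonempty : U.Nonempty) :
    ∃ G : Matrix γ κ 𝕜, IsUnit (1 - D * G) ∧ (1 - G * D)⁻¹ * G ∈ U := by
  obtain ⟨L, hL⟩ := hU_nonempty
  have hdense := (finite_setOf_det_one_add_smul_eq_zero (D * L)).countable.dense_compl 𝕜
  have hopen : IsOpen {t : 𝕜 | t • L ∈ U} := hU.preimage (by fun_prop)
  obtain ⟨t, htU, ht⟩ := hdense.inter_open_nonempty _ hopen ⟨1, by simpa using hL⟩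
  have hunit : IsUnit (1 + D * (t • L)) := by
    rw [isUnit_iff_isUnit_det, Matrix.mul_smul]
    exact isUnit_iff_ne_zero.mpr ht
  obtain ⟨G, hG, hGL⟩ := exists_one_sub_mul_inv_mul_eq hunit
  exact ⟨G, hG, by rwa [hGL]⟩

theorem isUnit_one_sub_fromBlocks_mul_iff {R β γ κ : Type*} [CommRing R] [Fintype β]
    [DecidableEq β] [Fintype γ] [Fintype κ] [DecidableEq κ] (D : Matrix κ γ R)
    (G : Matrix (β ⊕ γ) (β ⊕ κ) R) :
    IsUnit (1 - (fromBlocks 0 0 0 D : Matrix (β ⊕ κ) (β ⊕ γ) R) * G) ↔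
      IsUnit (1 - D * G.toBlocks₂₂) := by
  have hblocks : 1 - (fromBlocks 0 0 0 D : Matrix (β ⊕ κ) (β ⊕ γ) R) * G =
      fromBlocks 1 0 (-(D * G.toBlocks₂₁)) (1 - D * G.toBlocks₂₂) := by
    rw [← fromBlocks_toBlocks G, fromBlocks_multiply, ← fromBlocks_one, sub_eq_add_neg,
      fromBlocks_neg, fromBlocks_add]
    simp [sub_eq_add_neg]
  rw [hblocks, isUnit_fromBlocks_zero₁₂, and_iff_right isUnit_one]

section Controller

variable {d : ℕ} {m n nK : Fin d → ℕ} {r₁ r₂ s₁ s₂ : ℕ}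

theorem closedLoopA_eq_feedback (P : Plant 𝕜 m n r₁ r₂ s₁ s₂) (K : Controller 𝕜 m nK r₂ s₂) :
    closedLoopA P K = feedback P.A P.B₂ P.C₂
      ((1 - fromBlocks K.A K.B K.C K.D *
          (fromBlocks 0 0 0 P.D₂₂ : Matrix (StateIdx m nK ⊕ _) (StateIdx m nK ⊕ _) 𝕜))⁻¹ *
        fromBlocks K.A K.B K.C K.D) := by
  rw [feedback, ← Matrix.mul_assoc]
  rfl

theorem exists_wellPosed_norm_lt_one_iff (P : Plant 𝕜 m n r₁ r₂ s₁ s₂)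
    (S R : Matrix (StateIdx m n ⊕ StateIdx m nK) (StateIdx m n ⊕ StateIdx m nK) 𝕜) :
    (∃ K : Controller 𝕜 m nK r₂ s₂, WellPosed P K ∧ ‖S * closedLoopA P K * R‖ < 1) ↔
      ∃ G : Matrix (StateIdx m nK ⊕ Fin r₂) (StateIdx m nK ⊕ Fin s₂) 𝕜,
        ‖S * feedback P.A P.B₂ P.C₂ G * R‖ < 1 := by
  constructor
  · rintro ⟨K, -, hK⟩
    rw [closedLoopA_eq_feedback] at hK
    exact ⟨_, hK⟩
  · intro h
    have hopen : IsOpen {G : Matrix (StateIdx m nK ⊕ Fin r₂) (StateIdx m nK ⊕ Fin s₂) 𝕜 |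
        ‖S * feedback P.A P.B₂ P.C₂ G * R‖ < 1} := by
      refine isOpen_lt (Continuous.norm ?_) continuous_const
      unfold feedback
      fun_prop
    obtain ⟨G, hG, hG_norm⟩ :=
      exists_isUnit_one_sub_mul_of_isOpen (fromBlocks 0 0 0 P.D₂₂) hopen h
    refine ⟨⟨G.toBlocks₁₁, G.toBlocks₁₂, G.toBlocks₂₁, G.toBlocks₂₂⟩,
      (isUnit_one_sub_fromBlocks_mul_iff _ _).mp hG, ?_⟩
    rw [closedLoopA_eq_feedback, fromBlocks_toBlocks]
    exact hG_norm

theorem exists_wellPosed_closedLoopQStable_iff {ρ σ : Type*} [Fintype ρ] [Fintype σ]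
    (P : Plant 𝕜 m n r₁ r₂ s₁ s₂) {N : Matrix (StateIdx m n) ρ 𝕜} {W : Matrix (StateIdx m n) σ 𝕜}
    (hN : IsKernelBasis N P.B₂ᴴ) (hW : IsKernelBasis W P.C₂) :
    (∃ K : Controller 𝕜 m nK r₂ s₂, WellPosed P K ∧ ClosedLoopQStable P K) ↔
      ∃ Q ∈ commutant (closedLoopStructure 𝕜 m n nK), IsUnit Q ∧
        CompressedSteinInequalities P.A N W (Q * Qᴴ)⁻¹.toBlocks₁₁ (Q * Qᴴ).toBlocks₁₁ := by
  have hgain (Q : Matrix (StateIdx m n ⊕ StateIdx m nK) (StateIdx m n ⊕ StateIdx m nK) 𝕜)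
      (hQ : IsUnit Q) :=
    (exists_wellPosed_norm_lt_one_iff P Q⁻¹ Q).trans
      (exists_norm_feedback_lt_one_iff P.A hN hW hQ)
  constructor
  · rintro ⟨K, hK, Q, hQ, hQ_unit, hQ_norm⟩
    exact ⟨Q, hQ, hQ_unit, (hgain Q hQ_unit).mp ⟨K, hK, hQ_norm⟩⟩
  · rintro ⟨Q, hQ, hQ_unit, hstein⟩
    obtain ⟨K, hK, hQ_norm⟩ := (hgain Q hQ_unit).mpr hstein
    exact ⟨K, hK, Q, hQ, hQ_unit, hQ_norm⟩

end Controller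

end WellPosedness

end LFT

theorem theorem3p1 {𝕜 : Type*} [RCLike 𝕜] {d : ℕ} (m n nK : Fin d → ℕ) {r₁ r₂ s₁ s₂ : ℕ}
    (P : LFT.Plant 𝕜 m n r₁ r₂ s₁ s₂)
    {p q : ℕ} (Bperp : Matrix (LFT.StateIdx m n) (Fin p) 𝕜)
    (Cperp : Matrix (Fin q) (LFT.StateIdx m n) 𝕜)
    (hB_inj : Function.Injective Bperp.mulVecLin)
    (hB_range : LinearMap.range Bperp.mulVecLin = LinearMap.ker P.B₂.conjTranspose.mulVecLin)
    (hC_inj : Function.Injective Cperp.conjTranspose.mulVecLin)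
    (hC_range : LinearMap.range Cperp.conjTranspose.mulVecLin = LinearMap.ker P.C₂.mulVecLin) :
    (∃ K : LFT.Controller 𝕜 m nK r₂ s₂, LFT.WellPosed P K ∧ LFT.ClosedLoopQStable P K) ↔
      ∃ X ∈ LFT.commutant (LFT.openStructure 𝕜 m n),
      ∃ Y ∈ LFT.commutant (LFT.openStructure 𝕜 m n),
        X.PosDef ∧ Y.PosDef ∧
        (-(Bperp.conjTranspose * P.A * Y * P.A.conjTranspose * Bperp
            - Bperp.conjTranspose * Y * Bperp)).PosDef ∧
        (-(Cperp * P.A.conjTranspose * X * P.A * Cperp.conjTranspose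
            - Cperp * X * Cperp.conjTranspose)).PosDef ∧
        ∃ X₀ Y₀ : ∀ k : Fin d, Matrix (Fin (n k)) (Fin (n k)) 𝕜,
          X = LFT.repeatedBlocks m X₀ ∧ Y = LFT.repeatedBlocks m Y₀ ∧
          ∀ k : Fin d,
            (Matrix.fromBlocks (X₀ k) 1 1 (Y₀ k)).PosSemidef ∧
            (Matrix.fromBlocks (X₀ k) 1 1 (Y₀ k)).rank ≤ n k + nK k := by
  have hN : LFT.IsKernelBasis Bperp P.B₂.conjTranspose := ⟨hB_inj, hB_range⟩
  have hW : LFT.IsKernelBasis Cperp.conjTranspose P.C₂ := ⟨hC_inj, hC_range⟩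
  rw [LFT.exists_wellPosed_closedLoopQStable_iff P hN hW]
  simp only [LFT.CompressedSteinInequalities, Matrix.conjTranspose_conjTranspose, neg_sub]
  constructor
  · rintro ⟨Q, hQ, hQ_unit, hB, hC⟩
    have hQQ : (Q * Q.conjTranspose).PosDef :=
      Matrix.PosDef.mul_conjTranspose_self Q (Matrix.vecMul_injective_iff_isUnit.mpr hQ_unit)
    obtain ⟨X₀, Y₀, hX, hY, hXY⟩ :=
      LFT.exists_mem_commutant_toBlocks₁₁_gram_eq_iff.mp ⟨Q, hQ, hQ_unit, rfl, rfl⟩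
    exact ⟨(Q * Q.conjTranspose)⁻¹.toBlocks₁₁, hX ▸ LFT.repeatedBlocks_mem_commutant X₀,
      (Q * Q.conjTranspose).toBlocks₁₁, hY ▸ LFT.repeatedBlocks_mem_commutant Y₀,
      hQQ.inv.submatrix Sum.inl_injective, hQQ.submatrix Sum.inl_injective, hB, hC,
      X₀, Y₀, hX, hY, hXY⟩
  · rintro ⟨X, -, Y, -, -, -, hB, hC, hXY⟩
    obtain ⟨Q, hQ, hQ_unit, rfl, rfl⟩ := LFT.exists_mem_commutant_toBlocks₁₁_gram_eq_iff.mpr hXY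
    exact ⟨Q, hQ, hQ_unit, hB, hC⟩
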